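/- There is an absolute constant $C>0$ such that the following holds. Let $F$ be a forest on $t$ vertices, let $d\ge 1$ be an integer, and let $G$ be a finite simple graph of maximum degree at most $d$ that contains no subgraph (induced or not) isomorphic to $F$. Then $$\chi_a(G)\le C\,t^{8/3}\,d^{2/3},$$ where $\chi_a(G)$, the acyclic chromatic number of $G$, is the least $k$ such that $G$ has a proper $k$-colouring in which the union of any two colour classes induces a forest. -/

import Mathlib

namespace SimpleGraph

/-- A proper colouring is acyclic if the union of any two colour classes induces a forest. -/
def Coloring.IsAcyclic {V α : Type*} {G : SimpleGraph V} (φ : G.Coloring α) : Prop :=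
  ∀ a b : α, (G.induce {v | φ v = a ∨ φ v = b}).IsAcyclic

/-- `G` has an acyclic (proper) colouring with colours in `Fin k`. -/
def AcyclicColorable {V : Type*} (G : SimpleGraph V) (k : ℕ) : Prop :=
  ∃ φ : G.Coloring (Fin k), φ.IsAcyclic

/-- The acyclic chromatic number of a finite graph: the least `k` such that an acyclic
`k`-colouring exists. -/
noncomputable def acyclicChromaticNumber {V : Type*} [Finite V] (G : SimpleGraph V) : ℕ :=
  sInf {k : ℕ | G.AcyclicColorable k}

/-- Giving all vertices different colours yields an acyclic colouring. -/
theorem acyclicColorable_card {V : Type*} [Fintype V] (G : SimpleGraph V) :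
    G.AcyclicColorable (Fintype.card V) := by
  let e := Fintype.equivFin V
  let φ : G.Coloring (Fin (Fintype.card V)) := Coloring.mk e fun h he => h.ne (e.injective he)
  have hφ : Function.Injective φ := e.injective
  clear_value φ
  refine ⟨φ, ?_⟩
  intro a b v c hc
  have hthree := hc.three_le_length
  have hnodup := hc.support_nodup
  let f : {v : V | φ v = a ∨ φ v = b} → Bool := fun x => decide (φ x.1 = a)
  have hf : Function.Injective f := by
    rintro ⟨x, hx⟩ ⟨y, hy⟩ hxy
    simp only [f, decide_eq_decide] at hxy
    apply Subtype.ext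
    apply hφ
    replace hx : φ x = a ∨ φ x = b := hx
    replace hy : φ y = a ∨ φ y = b := hy
    grind
  have h2 := (hnodup.map hf).length_le_card
  rw [List.length_map, List.length_tail, Walk.length_support, Fintype.card_bool] at h2
  omega

/-- The minimum in the definition of the acyclic chromatic number is attained. -/
theorem acyclicColorable_acyclicChromaticNumber {V : Type*} [Finite V] (G : SimpleGraph V) :
    G.AcyclicColorable G.acyclicChromaticNumber := by
  have := Fintype.ofFinite V
  exact Nat.sInf_mem (s := {k : ℕ | G.AcyclicColorable k}) ⟨_, G.acyclicColorable_card⟩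

end SimpleGraph

/-!
Let `F` be a forest on `t` vertices and `G` an `F`-free graph of maximum degree at most `d`.

*Layers.* Starting from the set of all vertices, pass repeatedly to the vertices that have at least
`t` neighbours in the current set. If a vertex survived `t` rounds, then `F` could be embedded
greedily, leaf by leaf. So the round in which a vertex disappears defines a function `ℓ` with `t`
values, and each vertex has at most `t` upper neighbours, that is, neighbours in its own or in higher
layers (`SimpleGraph.IsAcyclic.exists_layering`).

*Configurations.* Every layer gets its own palette of `k` colours. A two-coloured cycle inside one
layer is excluded by a colouring that distinguishes vertices at distance at most two in that layer.
A cycle coloured with two colours from different layers alternates between a lower and a higher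
layer. If its length is at least six, it contains a path `u w u' w' u''` on which the `u`s are upper
neighbours of the `w`s; if it is four, it is a square `u w u' w'`. A vertex is on `O((ds)²)` such
paths, where `s = min t d`, but may be on too many squares. Therefore vertices `u`, `u'` that are
both upper neighbours of at least `m` vertices are required to have different colours. This concerns
at most `ds / m` partners of each `u`, and the other pairs leave at most `O(dsm)` squares at a
vertex. The reduction is `SimpleGraph.IsLayerwiseAcyclic.acyclicColorable`.

*Counting.* Colourings avoiding these pairs, squares and paths exist by a counting form of the local
lemma, `exists_forall_not_bad`, provided that a sum of order
`(s² + ds / m) / k + dsm / k² + (ds)² / k³` is at most a small constant. With `m` about `(ds)^(1/3)`,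
it suffices that `k` is a large multiple of `s²` and of `(ds)^(2/3)`. Both are at most
`t^(5/3) d^(2/3)`, and the `t` palettes together have `O(t^(8/3) d^(2/3))` colours.
-/

/-! ### A counting form of the local lemma -/

open Finset in
/-- If `P` does not look at the coordinates in `D`, while a function satisfying `Q` is determined
by its values off `D`, then among the functions satisfying `P` at most a proportion
`|α| ^ (-#D)` satisfies `Q`: redefining a function with `P ∧ Q` arbitrarily on `D` gives functions
with `P`, and the original function can be recovered from each of them. -/
theorem card_filter_mul_pow_le {V α : Type*} [Fintype V] [DecidableEq V] [Fintype α]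
    (P Q : (V → α) → Prop) [DecidablePred P] [DecidablePred Q] (D : Finset V)
    (hP : ∀ f g : V → α, (∀ x ∉ D, f x = g x) → P f → P g)
    (hQ : ∀ f g : V → α, Q f → Q g → (∀ x ∉ D, f x = g x) → f = g) :
    #{f | P f ∧ Q f} * Fintype.card α ^ #D ≤ #{f | P f} := by
  classical
  have hc : Fintype.card α ^ #D = #(univ : Finset (D → α)) := by simp
  rw [hc, ← card_product]
  refine card_le_card_of_injOn (fun p x => if h : x ∈ D then p.2 ⟨x, h⟩ else p.1 x) ?_ ?_
  · rintro ⟨f, h⟩ hf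
    simp only [coe_product, Set.mem_prod, mem_coe, mem_filter, mem_univ, true_and, and_true]
      at hf ⊢
    exact hP f _ (fun x hx => by simp [hx]) hf.1
  · rintro ⟨f, h⟩ hf ⟨g, h'⟩ hg heq
    simp only [coe_product, Set.mem_prod, mem_coe, mem_filter, mem_univ, true_and, and_true]
      at hf hg
    have key : ∀ x, (if hx : x ∈ D then h ⟨x, hx⟩ else f x) =
        if hx : x ∈ D then h' ⟨x, hx⟩ else g x := fun x => congrFun heq x
    refine Prod.ext (hQ f g hf.2 hg.2 fun x hx => by simpa [hx] using key x) ?_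
    ext ⟨x, hx⟩
    simpa [hx] using key x

open Finset in
/-- A counting substitute for the Lovász local lemma, due to Rosenfeld. Each constraint `c` depends
on the coordinates in `supp c`, and each `v ∈ supp c` lies in a set of `r c` coordinates whose values
in a function bad for `c` are determined by the remaining ones. If for every `v` the weights
`(2 / |α|) ^ r c` of the constraints involving `v` add up to at most `1`, then some function
satisfies all constraints.

The proof shows that the number `N S` of functions satisfying the constraints supported in `S` at
most halves when one element is added to `S`. -/
theorem exists_forall_not_bad {V α ι : Type*} [Fintype V] [Fintype α] [Nonempty α]
    [DecidableEq V]
    (C : Finset ι) (supp : ι → Finset V) (bad : ι → (V → α) → Prop) (r : ι → ℕ)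
    (hne : ∀ c ∈ C, (supp c).Nonempty)
    (hloc : ∀ c ∈ C, ∀ f g : V → α, (∀ x ∈ supp c, f x = g x) → bad c f → bad c g)
    (hdet : ∀ c ∈ C, ∀ v ∈ supp c, ∃ D : Finset V, v ∈ D ∧ #D = r c ∧
      ∀ f g : V → α, bad c f → bad c g → (∀ x ∉ D, f x = g x) → f = g)
    (hw : ∀ v, ∑ c ∈ C with v ∈ supp c, (2 / (Fintype.card α : ℝ)) ^ r c ≤ 1) :
    ∃ f : V → α, ∀ c ∈ C, ¬ bad c f := by
  classical
  set k : ℝ := (Fintype.card α : ℝ) with hk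
  have hk0 : 0 < k := by simpa [hk] using Fintype.card_pos (α := α)
  let good (S : Finset V) (f : V → α) : Prop := ∀ c ∈ C, supp c ⊆ S → ¬ bad c f
  let N (S : Finset V) : ℝ := #{f | good S f}
  have key : ∀ n, ∀ S : Finset V, #S = n → ∀ v ∉ S, N S ≤ 2 * N (insert v S) := by
    intro n
    induction n using Nat.strong_induction_on with
    | _ n ih =>
    intro S hS v hv
    -- removing the vertices of `E` multiplies the count by at most `2 ^ #E`
    have chain : ∀ E : Finset V, E ⊆ S → N (S \ E) ≤ 2 ^ #E * N S := by
      intro E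
      induction E using Finset.induction_on with
      | empty => simp
      | insert a E ha hE =>
        intro hsub
        have haS : a ∈ S := hsub (mem_insert_self a E)
        have h1 := ih #(S \ insert a E) (hS ▸ card_lt_card
          ⟨sdiff_subset, fun h => by simpa using h haS⟩) _ rfl a (by simp)
        have h2 : insert a (S \ insert a E) = S \ E := by
          ext x; simp only [mem_insert, mem_sdiff]; grind
        rw [h2] at h1
        have h3 := hE ((subset_insert a E).trans hsub)
        rw [card_insert_of_notMem ha, pow_succ]
        linarith
    -- a constraint involving `v` is violated by few of the functions counted by `N S`: resampling
    -- on `D` gains a factor `k ^ r c`, and costs at most `2 ^ (r c - 1)` for passing from `S` to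
    -- `S \ D`, which removes at most `r c - 1` elements since `v ∉ S`
    have hbad : ∀ c ∈ C, v ∈ supp c →
        (#{f | good S f ∧ bad c f} : ℝ) ≤ (2 / k) ^ r c * (N S / 2) := by
      intro c hc hvc
      obtain ⟨D, hvD, hDr, hD⟩ := hdet c hc v hvc
      have h1 := card_filter_mul_pow_le (good (S \ D)) (bad c) D (fun f g hfg hf c' hc' hs hb =>
        hf c' hc' hs (hloc c' hc' g f (fun x hx => (hfg x (mem_sdiff.1 (hs hx)).2).symm) hb)) hD
      have h2 : #{f | good S f ∧ bad c f} ≤ #{f | good (S \ D) f ∧ bad c f} :=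
        card_le_card fun f hf => by
          simp only [mem_filter, mem_univ, true_and] at hf ⊢
          exact ⟨fun c' hc' hs => hf.1 c' hc' (hs.trans sdiff_subset), hf.2⟩
      have h3 : N (S \ D) ≤ 2 ^ (r c - 1) * N S := by
        have h4 := chain (S ∩ D) inter_subset_left
        rw [sdiff_inter_self_left] at h4
        refine h4.trans ?_
        gcongr
        · norm_num
        · rw [← hDr, ← card_erase_of_mem hvD]
          exact card_le_card fun x hx => by grind
      have hr : r c - 1 + 1 = r c := by
        have := card_pos.2 ⟨v, hvD⟩
        omega
      have h5 : (#{f | good S f ∧ bad c f} : ℝ) * k ^ r c ≤ N (S \ D) := by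
        rw [← hDr, hk]
        simp only [N]
        exact_mod_cast (Nat.mul_le_mul_right _ h2).trans h1
      rw [div_pow, div_mul_eq_mul_div, le_div_iff₀ (by positivity)]
      refine (h5.trans h3).trans (le_of_eq ?_)
      conv_rhs => rw [← hr, pow_succ]
      ring
    have hsplit : N S ≤ N (insert v S) +
        ∑ c ∈ C with v ∈ supp c, (#{f | good S f ∧ bad c f} : ℝ) := by
      have hsub : ({f | good S f} : Finset (V → α)) ⊆
          ({f | good (insert v S) f} : Finset (V → α)) ∪
          (C.filter fun c => v ∈ supp c).biUnion fun c => {f | good S f ∧ bad c f} := by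
        intro f hf
        simp only [mem_filter, mem_univ, true_and, mem_union, mem_biUnion] at hf ⊢
        by_contra! hcon
        refine hcon.1 fun c hc hs hb => ?_
        by_cases hvc : v ∈ supp c
        · exact hcon.2 c ⟨hc, hvc⟩ hf hb
        · exact hf c hc ((subset_insert_iff_of_notMem hvc).1 hs) hb
      have := (card_le_card hsub).trans ((card_union_le _ _).trans
        (Nat.add_le_add_left card_biUnion_le _))
      simp only [N]
      exact_mod_cast this
    have hsum : ∑ c ∈ C with v ∈ supp c, (#{f | good S f ∧ bad c f} : ℝ) ≤ N S / 2 := by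
      calc _ ≤ ∑ c ∈ C with v ∈ supp c, (2 / k) ^ r c * (N S / 2) :=
            sum_le_sum fun c hc => hbad c (mem_filter.1 hc).1 (mem_filter.1 hc).2
        _ = (∑ c ∈ C with v ∈ supp c, (2 / k) ^ r c) * (N S / 2) := by rw [sum_mul]
        _ ≤ 1 * (N S / 2) := by
            gcongr
            exact hw v
        _ = N S / 2 := one_mul _
    linarith
  have hpos : ∀ S : Finset V, 0 < N S := by
    intro S
    induction S using Finset.induction_on with
    | empty =>
      simp only [N, Nat.cast_pos, card_pos]
      refine ⟨fun _ => Classical.arbitrary α, ?_⟩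
      simp only [mem_filter, mem_univ, true_and]
      intro c hc hs
      exact absurd (subset_empty.1 hs) (hne c hc).ne_empty
    | insert a S ha hS => linarith [key _ S rfl a ha]
  have := hpos univ
  simp only [N, Nat.cast_pos, card_pos] at this
  obtain ⟨f, hf⟩ := this
  exact ⟨f, fun c hc => (mem_filter.1 hf).2 c hc (subset_univ _)⟩

/-! ### Layers of a graph excluding a forest -/

namespace SimpleGraph

/-- A nonempty finite forest has a vertex of degree at most one, namely an end of a longest path. -/
theorem IsAcyclic.exists_subsingleton_neighborSet {V : Type*} [Finite V] [Nonempty V]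
    {G : SimpleGraph V} (hG : G.IsAcyclic) : ∃ x, (G.neighborSet x).Subsingleton := by
  obtain ⟨u, v, p, hp, hmax⟩ := Walk.exists_isPath_forall_isPath_length_le_length G
  have hsupp : ∀ w, G.Adj u w → w ∈ p.support := by
    intro w hw
    by_contra hcon
    have := hmax _ _ _ ((Walk.cons_isPath_iff hw.symm p).2 ⟨hp, hcon⟩)
    simp at this
  refine ⟨u, fun a ha b hb => ?_⟩
  rw [hG.eq_snd_of_adj_start hp ha (hsupp a ha), hG.eq_snd_of_adj_start hp hb (hsupp b hb)]

theorem IsAcyclic.exists_mem_subsingleton_adj {V : Type*} {G : SimpleGraph V} (hG : G.IsAcyclic)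
    (S : Finset V) (hS : S.Nonempty) :
    ∃ x ∈ S, ∀ y ∈ S, ∀ z ∈ S, G.Adj x y → G.Adj x z → y = z := by
  have : Nonempty (S : Set V) := hS.to_subtype
  obtain ⟨x, hx⟩ := (hG.induce (S : Set V)).exists_subsingleton_neighborSet
  refine ⟨x, x.2, fun y hy z hz hxy hxz => ?_⟩
  exact congrArg Subtype.val (@hx ⟨y, hy⟩ hxy ⟨z, hz⟩ hxz)

open Classical Finset in
/-- The cores of `G` for the threshold `t`: the first is the set of all vertices, and each of the
following consists of those vertices of the one before that have at least `t` neighbours in it. -/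
noncomputable def iteratedCore {V : Type*} [Fintype V] (G : SimpleGraph V) (t : ℕ) : ℕ → Finset V
  | 0 => univ
  | i + 1 => {v ∈ iteratedCore G t i | t ≤ #{u ∈ iteratedCore G t i | G.Adj v u}}

open Classical Finset in
theorem mem_iteratedCore_succ {V : Type*} [Fintype V] {G : SimpleGraph V} {t i : ℕ} {v : V} :
    v ∈ G.iteratedCore t (i + 1) ↔
      v ∈ G.iteratedCore t i ∧ t ≤ #{u ∈ G.iteratedCore t i | G.Adj v u} := by
  simp [iteratedCore]

theorem iteratedCore_antitone {V : Type*} [Fintype V] (G : SimpleGraph V) (t : ℕ) :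
    Antitone (G.iteratedCore t) :=
  antitone_nat_of_succ_le fun _ _ hv => (mem_iteratedCore_succ.1 hv).1

open Finset in
/-- If the `t`-th core is nonempty, then a set `S` of at most `t` vertices of a forest embeds in
`G`. The stronger claim that the images lie in the core of index `t - #S` makes the induction on
`#S` work: after the removal of a leaf `x`, the image of its neighbour has at least `t > #S - 1`
neighbours in the next lower core, so that one of them is free to be the image of `x`. -/
theorem IsAcyclic.exists_partial_embedding {W V : Type*} {F : SimpleGraph W}
    (hF : F.IsAcyclic) [Fintype V] (G : SimpleGraph V) (t : ℕ)
    (ht : (G.iteratedCore t t).Nonempty) (S : Finset W) (hS : #S ≤ t) :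
    ∃ f : W → V, (∀ x ∈ S, f x ∈ G.iteratedCore t (t - #S)) ∧ Set.InjOn f S ∧
      ∀ x ∈ S, ∀ y ∈ S, F.Adj x y → G.Adj (f x) (f y) := by
  classical
  induction hn : #S generalizing S with
  | zero =>
    obtain ⟨z, hz⟩ := ht
    refine ⟨fun _ => z, ?_⟩
    simp [card_eq_zero.1 hn]
  | succ n ih =>
    obtain ⟨x, hxS, hx⟩ := hF.exists_mem_subsingleton_adj S (card_pos.1 (by omega))
    have hcard : #(S.erase x) = n := by rw [card_erase_of_mem hxS]; omega
    obtain ⟨f, hfc, hfi, hfa⟩ := ih (S.erase x) (by omega) hcard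
    have ht' : t - n = t - (n + 1) + 1 := by omega
    -- the image of the neighbour of `x`, or an arbitrary vertex if `x` has no neighbour
    obtain ⟨z, hzc, hz⟩ : ∃ z ∈ G.iteratedCore t (t - n), ∀ y ∈ S, F.Adj x y → z = f y := by
      by_cases h : ∃ y ∈ S, F.Adj x y
      · obtain ⟨y, hy, hxy⟩ := h
        exact ⟨f y, hfc y (mem_erase.2 ⟨hxy.ne', hy⟩), fun y' hy' hxy' => by
          rw [hx y hy y' hy' hxy hxy']⟩
      · obtain ⟨z, hz⟩ := ht
        exact ⟨z, G.iteratedCore_antitone t (Nat.sub_le t n) hz, fun y hy hxy =>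
          absurd ⟨y, hy, hxy⟩ h⟩
    rw [ht', mem_iteratedCore_succ] at hzc
    obtain ⟨w, hw, hwf⟩ := exists_mem_notMem_of_card_lt_card
      (s := (S.erase x).image f) (t := {u ∈ G.iteratedCore t (t - (n + 1)) | G.Adj z u})
      (lt_of_lt_of_le (lt_of_le_of_lt card_image_le (by omega)) hzc.2)
    rw [mem_filter] at hw
    have hwf' : ∀ y ∈ S, y ≠ x → f y ≠ w := fun y hy hyx h =>
      hwf (mem_image.2 ⟨y, mem_erase.2 ⟨hyx, hy⟩, h⟩)
    refine ⟨Function.update f x w, ?_, ?_, ?_⟩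
    · intro y hy
      by_cases hyx : y = x
      · subst hyx; simpa using hw.1
      · rw [Function.update_of_ne hyx]
        exact G.iteratedCore_antitone t (by omega) (hfc y (mem_erase.2 ⟨hyx, hy⟩))
    · intro a ha b hb hab
      by_cases hax : a = x <;> by_cases hbx : b = x
      · rw [hax, hbx]
      · subst hax
        rw [Function.update_self, Function.update_of_ne hbx] at hab
        exact absurd hab.symm (hwf' b hb hbx)
      · subst hbx
        rw [Function.update_self, Function.update_of_ne hax] at hab
        exact absurd hab (hwf' a ha hax)
      · rw [Function.update_of_ne hax, Function.update_of_ne hbx] at hab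
        exact hfi (by simp_all) (by simp_all) hab
    · intro a ha b hb hab
      by_cases hax : a = x <;> by_cases hbx : b = x
      · exact absurd (hax.trans hbx.symm) hab.ne
      · subst hax
        rw [Function.update_self, Function.update_of_ne hbx, ← hz b hb hab]
        exact hw.2.symm
      · subst hbx
        rw [Function.update_self, Function.update_of_ne hax, ← hz a ha hab.symm]
        exact hw.2
      · rw [Function.update_of_ne hax, Function.update_of_ne hbx]
        exact hfa a (mem_erase.2 ⟨hax, ha⟩) b (mem_erase.2 ⟨hbx, hb⟩) hab

theorem IsAcyclic.iteratedCore_eq_empty {W V : Type*} [Fintype W] {F : SimpleGraph W}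
    (hF : F.IsAcyclic) [Fintype V] {G : SimpleGraph V} (hG : F.Free G) :
    G.iteratedCore (Fintype.card W) (Fintype.card W) = ∅ := by
  by_contra hne
  obtain ⟨f, -, hfi, hfa⟩ := hF.exists_partial_embedding G (Fintype.card W)
    (Finset.nonempty_iff_ne_empty.2 hne) Finset.univ le_rfl
  refine hG ⟨⟨⟨f, fun {a b} h => hfa a (Finset.mem_univ a) b (Finset.mem_univ b) h⟩, ?_⟩⟩
  exact fun a b h => hfi (by simp) (by simp) h

/-- `u` is an upper neighbour of `w` for the layering `ℓ`: adjacent to `w`, and in the same layer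
or a higher one. -/
def IsUpper {V T : Type*} [LE T] (G : SimpleGraph V) (ℓ : V → T) (w u : V) : Prop :=
  G.Adj w u ∧ ℓ w ≤ ℓ u

open Classical Finset in
/-- A graph without a subgraph isomorphic to a forest on `t` vertices can be divided into `t` layers
such that each vertex has at most `t` neighbours in its own or in higher layers: the layer of a
vertex is the index of the last core containing it. -/
theorem IsAcyclic.exists_layering {W V : Type*} [Fintype W] {F : SimpleGraph W}
    (hF : F.IsAcyclic) [Fintype V] {G : SimpleGraph V} (hG : F.Free G) :
    ∃ ℓ : V → Fin (Fintype.card W),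
      ∀ v, #{u | G.IsUpper ℓ v u} ≤ Fintype.card W := by
  set t := Fintype.card W with ht
  have hempty : G.iteratedCore t t = ∅ := hF.iteratedCore_eq_empty hG
  have hex : ∀ v, ∃ i : Fin t, v ∈ G.iteratedCore t i ∧ v ∉ G.iteratedCore t (i + 1) := by
    intro v
    by_contra! hcon
    have hall : ∀ i ≤ t, v ∈ G.iteratedCore t i := by
      intro i
      induction i with
      | zero => simp [iteratedCore]
      | succ i ih => exact fun hi => hcon ⟨i, hi⟩ (ih (by omega))
    simpa [hempty] using hall t le_rfl
  choose ℓ hℓ hℓ' using hex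
  refine ⟨ℓ, fun v => ?_⟩
  by_contra! hcon
  refine hℓ' v (mem_iteratedCore_succ.2 ⟨hℓ v, hcon.le.trans (card_le_card fun u hu => ?_)⟩)
  simp only [mem_filter, mem_univ, true_and] at hu ⊢
  exact ⟨G.iteratedCore_antitone t hu.2 (hℓ u), hu.1⟩

end SimpleGraph

/-! ### Counting tuples by successive choices -/

section Counting
open Finset

theorem card_le_mul_of_fiber {τ α : Type*} [DecidableEq α] {S : Finset τ} (g : τ → α)
    (A : Finset α) {a n : ℕ} (hg : ∀ x ∈ S, g x ∈ A) (hA : #A ≤ a)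
    (hn : ∀ y, #{x ∈ S | g x = y} ≤ n) : #S ≤ a * n :=
  (card_le_mul_card_image_of_maps_to hg n fun y _ => hn y).trans
    ((mul_comm _ _).trans_le (Nat.mul_le_mul_right n hA))

/-- Elements determined by three parameters, chosen one after the other from at most `a`, `b` and
`c` possibilities. The bounds are needed only at the values of parameters that occur. -/
theorem card_le_of_three_choices {τ α : Type*} [DecidableEq α] {S : Finset τ} (g₁ g₂ g₃ : τ → α)
    (A : Finset α) (B : α → Finset α) (C : α → α → Finset α) {a b c : ℕ}
    (hinj : ∀ x ∈ S, ∀ y ∈ S, g₁ x = g₁ y → g₂ x = g₂ y → g₃ x = g₃ y → x = y)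
    (h₁ : ∀ x ∈ S, g₁ x ∈ A ∧ #A ≤ a)
    (h₂ : ∀ x ∈ S, g₂ x ∈ B (g₁ x) ∧ #(B (g₁ x)) ≤ b)
    (h₃ : ∀ x ∈ S, g₃ x ∈ C (g₁ x) (g₂ x) ∧ #(C (g₁ x) (g₂ x)) ≤ c) :
    #S ≤ a * (b * c) := by
  rcases S.eq_empty_or_nonempty with rfl | ⟨x₀, hx₀⟩
  · simp
  refine card_le_mul_of_fiber g₁ A (fun x hx => (h₁ x hx).1) (h₁ x₀ hx₀).2 fun y => ?_
  rcases (S.filter fun x => g₁ x = y).eq_empty_or_nonempty with he | ⟨x₁, hx₁⟩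
  · simp [he]
  rw [mem_filter] at hx₁
  refine card_le_mul_of_fiber g₂ (B y) ?_ (hx₁.2 ▸ (h₂ x₁ hx₁.1).2) fun z => ?_
  · intro x hx
    rw [mem_filter] at hx
    exact hx.2 ▸ (h₂ x hx.1).1
  rcases ((S.filter fun x => g₁ x = y).filter fun x => g₂ x = z).eq_empty_or_nonempty with
    he | ⟨x₂, hx₂⟩
  · simp [he]
  simp only [mem_filter] at hx₂
  have hc : #(C y z) ≤ c := by
    have := (h₃ x₂ hx₂.1.1).2
    rwa [hx₂.1.2, hx₂.2] at this
  refine le_trans (card_le_card_of_injOn g₃ ?_ ?_) hc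
  · intro x hx
    simp only [coe_filter, mem_filter, Set.mem_ofPred_eq] at hx
    have := (h₃ x hx.1.1).1
    rwa [hx.1.2, hx.2] at this
  · intro x hx x' hx'
    simp only [coe_filter, mem_filter, Set.mem_ofPred_eq] at hx hx'
    exact hinj x hx.1.1 x' hx'.1.1 (hx.1.2.trans hx'.1.2.symm) (hx.2.trans hx'.2.symm)

theorem card_le_of_four_choices {τ α : Type*} [DecidableEq α] {S : Finset τ}
    (g₁ g₂ g₃ g₄ : τ → α)
    (A : Finset α) (B : α → Finset α) (C : α → α → Finset α) (D : α → α → α → Finset α)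
    {a b c d : ℕ}
    (hinj : ∀ x ∈ S, ∀ y ∈ S, g₁ x = g₁ y → g₂ x = g₂ y → g₃ x = g₃ y → g₄ x = g₄ y → x = y)
    (h₁ : ∀ x ∈ S, g₁ x ∈ A ∧ #A ≤ a)
    (h₂ : ∀ x ∈ S, g₂ x ∈ B (g₁ x) ∧ #(B (g₁ x)) ≤ b)
    (h₃ : ∀ x ∈ S, g₃ x ∈ C (g₁ x) (g₂ x) ∧ #(C (g₁ x) (g₂ x)) ≤ c)
    (h₄ : ∀ x ∈ S, g₄ x ∈ D (g₁ x) (g₂ x) (g₃ x) ∧ #(D (g₁ x) (g₂ x) (g₃ x)) ≤ d) :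
    #S ≤ a * (b * (c * d)) := by
  rcases S.eq_empty_or_nonempty with rfl | ⟨x₀, hx₀⟩
  · simp
  refine card_le_mul_of_fiber g₁ A (fun x hx => (h₁ x hx).1) (h₁ x₀ hx₀).2 fun y => ?_
  refine card_le_of_three_choices g₂ g₃ g₄ (B y) (C y) (D y) ?_ ?_ ?_ ?_
  · intro x hx x' hx'
    rw [mem_filter] at hx hx'
    exact hinj x hx.1 x' hx'.1 (hx.2.trans hx'.2.symm)
  all_goals
    intro x hx
    rw [mem_filter] at hx
    obtain ⟨hx, rfl⟩ := hx
  · exact h₂ x hx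
  · exact h₃ x hx
  · exact h₄ x hx

end Counting

/-! ### Excluded configurations and their number -/

namespace SimpleGraph

section Layered
variable {V T : Type*} [LinearOrder T]

open Classical Finset in
/-- The number of vertices having both `a` and `b` as upper neighbours. -/
noncomputable def codegree [Fintype V] (G : SimpleGraph V) (ℓ : V → T) (a b : V) : ℕ :=
  #{w | G.IsUpper ℓ w a ∧ G.IsUpper ℓ w b}

/-- Pairs of distinct vertices that must receive different colours: those in the same layer at
distance at most two inside the layer, and those that are both upper neighbours of at least `m`
vertices. -/
def Conflict [Fintype V] (G : SimpleGraph V) (ℓ : V → T) (m : ℕ) (a b : V) : Prop :=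
  a ≠ b ∧ (ℓ a = ℓ b ∧ (G.Adj a b ∨ ∃ c, ℓ c = ℓ a ∧ G.Adj a c ∧ G.Adj c b) ∨
    m ≤ G.codegree ℓ a b)

/-- `u w u' w'` is a 4-cycle in which `u` and `u'` are upper neighbours of both `w` and `w'`, but of
fewer than `m` vertices altogether. -/
def IsThinSquare [Fintype V] (G : SimpleGraph V) (ℓ : V → T) (m : ℕ) (u w u' w' : V) : Prop :=
  (u ≠ u' ∧ w ≠ w') ∧ (G.IsUpper ℓ w u ∧ G.IsUpper ℓ w u' ∧ G.IsUpper ℓ w' u ∧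
    G.IsUpper ℓ w' u') ∧ G.codegree ℓ u u' < m

/-- `u w u' w' u''` is a path on five vertices on which the first, third and fifth vertex are upper
neighbours of the vertices next to them. -/
def IsZigzag (G : SimpleGraph V) (ℓ : V → T) (u w u' w' u'' : V) : Prop :=
  (u ≠ u' ∧ u ≠ u'' ∧ u' ≠ u'' ∧ w ≠ w' ∧ w ≠ u'' ∧ w' ≠ u) ∧
    G.IsUpper ℓ w u ∧ G.IsUpper ℓ w u' ∧ G.IsUpper ℓ w' u' ∧ G.IsUpper ℓ w' u''

/-- A colouring `f` that distinguishes conflicting pairs and for which no thin square and no zigzag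
is coloured alternately with two colours. These conditions ensure that `v ↦ (ℓ v, f v)` is an
acyclic colouring. -/
structure IsLayerwiseAcyclic [Fintype V] {α : Type*} (G : SimpleGraph V) (ℓ : V → T) (m : ℕ)
    (f : V → α) : Prop where
  conflict : ∀ a b, G.Conflict ℓ m a b → f a ≠ f b
  square : ∀ u w u' w', G.IsThinSquare ℓ m u w u' w' → ¬ (f u = f u' ∧ f w = f w')
  zigzag : ∀ u w u' w' u'', G.IsZigzag ℓ u w u' w' u'' →
    ¬ (f u = f u' ∧ f u = f u'' ∧ f w = f w')

variable [Fintype V] (G : SimpleGraph V) (ℓ : V → T) {d s : ℕ} (m : ℕ)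

theorem codegree_comm (a b : V) : G.codegree ℓ a b = G.codegree ℓ b a := by
  classical
  unfold codegree
  refine congrArg Finset.card (Finset.filter_congr fun w _ => and_comm)

variable {G ℓ m} in
theorem Conflict.symm {a b : V} (h : G.Conflict ℓ m a b) : G.Conflict ℓ m b a := by
  obtain ⟨hne, ⟨hl, h | ⟨c, hc, h, h'⟩⟩ | h⟩ := h
  · exact ⟨hne.symm, .inl ⟨hl.symm, .inl h.symm⟩⟩
  · exact ⟨hne.symm, .inl ⟨hl.symm, .inr ⟨c, hc.trans hl, h'.symm, h.symm⟩⟩⟩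
  · exact ⟨hne.symm, .inr (G.codegree_comm ℓ a b ▸ h)⟩

open Classical Finset in
/-- Few vertices have large codegree with `v`, as there are at most `d * s` walks of length two
that start at `v` and end with a step to an upper neighbour. -/
theorem card_codegree_ge_le (hm : 0 < m) (hd : ∀ v, #{u | G.Adj v u} ≤ d)
    (hs : ∀ v, #{u | G.IsUpper ℓ v u} ≤ s) (v : V) :
    #{b | m ≤ G.codegree ℓ v b} ≤ d * s / m := by
  rw [Nat.le_div_iff_mul_le hm]
  calc #{b | m ≤ G.codegree ℓ v b} * m
      = ∑ b with m ≤ G.codegree ℓ v b, m := by rw [sum_const, smul_eq_mul]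
    _ ≤ ∑ b with m ≤ G.codegree ℓ v b, G.codegree ℓ v b :=
        sum_le_sum fun b hb => (mem_filter.1 hb).2
    _ ≤ ∑ b, G.codegree ℓ v b := sum_le_sum_of_subset (filter_subset _ _)
    _ = ∑ b, #(bipartiteAbove (fun b w => G.IsUpper ℓ w b) {w | G.IsUpper ℓ w v} b) := by
        simp only [codegree, bipartiteAbove, filter_filter]
    _ = ∑ w with G.IsUpper ℓ w v, #{b | G.IsUpper ℓ w b} :=
        sum_card_bipartiteAbove_eq_sum_card_bipartiteBelow _
    _ ≤ #{w | G.IsUpper ℓ w v} * s := sum_le_card_nsmul _ _ _ fun w _ => hs w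
    _ ≤ d * s := by
        refine Nat.mul_le_mul_right s (le_trans (card_le_card fun w hw => ?_) (hd v))
        simp only [mem_filter, mem_univ, true_and] at hw ⊢
        exact hw.1.symm

open Classical Finset in
theorem card_conflict_le (hm : 0 < m) (hd : ∀ v, #{u | G.Adj v u} ≤ d)
    (hs : ∀ v, #{u | G.IsUpper ℓ v u} ≤ s) (v : V) :
    #{b | G.Conflict ℓ m v b} ≤ s + s * s + d * s / m := by
  have hsub : ({b | G.Conflict ℓ m v b} : Finset V) ⊆
      ((({u | G.IsUpper ℓ v u} : Finset V) ∪
        ({u | G.IsUpper ℓ v u} : Finset V).biUnion fun c => {u | G.IsUpper ℓ c u}) ∪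
        ({b | m ≤ G.codegree ℓ v b} : Finset V)) := by
    intro b hb
    simp only [mem_filter, mem_univ, true_and, mem_union, mem_biUnion] at hb ⊢
    obtain ⟨-, ⟨hl, h | ⟨c, hc, h, h'⟩⟩ | h⟩ := hb
    · exact .inl (.inl ⟨h, hl.le⟩)
    · exact .inl (.inr ⟨c, ⟨h, hc.ge⟩, h', (hc.trans hl).le⟩)
    · exact .inr h
  refine (card_le_card hsub).trans ((card_union_le _ _).trans (add_le_add
    ((card_union_le _ _).trans (add_le_add (hs v) ?_)) (G.card_codegree_ge_le ℓ m hm hd hs v)))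
  exact (card_biUnion_le_card_mul _ _ _ fun c _ => hs c).trans (Nat.mul_le_mul_right s (hs v))

open Classical Finset in
theorem card_conflict_mem_le (hm : 0 < m) (hd : ∀ v, #{u | G.Adj v u} ≤ d)
    (hs : ∀ v, #{u | G.IsUpper ℓ v u} ≤ s) (v : V) :
    #{p : V × V | G.Conflict ℓ m p.1 p.2 ∧ (v = p.1 ∨ v = p.2)} ≤
      2 * (s + s * s + d * s / m) := by
  have hsub : ({p : V × V | G.Conflict ℓ m p.1 p.2 ∧ (v = p.1 ∨ v = p.2)} : Finset (V × V)) ⊆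
      ({b | G.Conflict ℓ m v b} : Finset V).image (fun b => (v, b)) ∪
      ({b | G.Conflict ℓ m v b} : Finset V).image (fun b => (b, v)) := by
    rintro ⟨a, b⟩ hp
    simp only [mem_filter, mem_univ, true_and, mem_union, mem_image, Prod.mk.injEq] at hp ⊢
    obtain ⟨h, rfl | rfl⟩ := hp
    · exact .inl ⟨b, h, rfl, rfl⟩
    · exact .inr ⟨a, h.symm, rfl, rfl⟩
  have hv := G.card_conflict_le ℓ m hm hd hs v
  have := (card_le_card hsub).trans ((card_union_le _ _).trans
    (add_le_add (card_image_le.trans hv) (card_image_le.trans hv)))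
  omega

open Classical Finset in
theorem card_thinSquare_mem_le (hd : ∀ v, #{u | G.Adj v u} ≤ d)
    (hs : ∀ v, #{u | G.IsUpper ℓ v u} ≤ s) (hsd : s ≤ d) (v : V) :
    #{p : V × V × V × V | G.IsThinSquare ℓ m p.1 p.2.1 p.2.2.1 p.2.2.2 ∧
      (v = p.1 ∨ v = p.2.1 ∨ v = p.2.2.1 ∨ v = p.2.2.2)} ≤ 4 * (d * (s * m)) := by
  let Q : V × V × V × V → Prop := fun p => G.IsThinSquare ℓ m p.1 p.2.1 p.2.2.1 p.2.2.2
  -- the number of thin squares with `v` in a given position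
  have h1 : #{p | Q p ∧ v = p.1} ≤ d * (s * m) := by
    refine card_le_of_three_choices (fun p => p.2.1) (fun p => p.2.2.1) (fun p => p.2.2.2)
      {w | G.Adj v w} (fun w => {u | G.IsUpper ℓ w u})
      (fun _ u => {w | G.IsUpper ℓ w v ∧ G.IsUpper ℓ w u}) ?_ ?_ ?_ ?_
    · rintro ⟨u, w, u', w'⟩ h ⟨x, y, x', y'⟩ h'
      grind
    all_goals
      rintro ⟨u, w, u', w'⟩ h
      simp only [mem_filter, mem_univ, true_and, Q] at h ⊢
      obtain ⟨⟨-, ⟨h1, h2, h3, h4⟩, h5⟩, rfl⟩ := h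
    · exact ⟨h1.1.symm, hd _⟩
    · exact ⟨h2, hs _⟩
    · exact ⟨⟨h3, h4⟩, h5.le⟩
  have h2 : #{p | Q p ∧ v = p.2.2.1} ≤ d * (s * m) := by
    refine card_le_of_three_choices (fun p => p.2.1) (fun p => p.1) (fun p => p.2.2.2)
      {w | G.Adj v w} (fun w => {u | G.IsUpper ℓ w u})
      (fun _ u => {w | G.IsUpper ℓ w u ∧ G.IsUpper ℓ w v}) ?_ ?_ ?_ ?_
    · rintro ⟨u, w, u', w'⟩ h ⟨x, y, x', y'⟩ h'
      grind
    all_goals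
      rintro ⟨u, w, u', w'⟩ h
      simp only [mem_filter, mem_univ, true_and, Q] at h ⊢
      obtain ⟨⟨-, ⟨h1, h2, h3, h4⟩, h5⟩, rfl⟩ := h
    · exact ⟨h2.1.symm, hd _⟩
    · exact ⟨h1, hs _⟩
    · exact ⟨⟨h3, h4⟩, h5.le⟩
  have h3 : #{p | Q p ∧ v = p.2.1} ≤ d * (s * m) := by
    refine card_le_of_three_choices (fun p => p.1) (fun p => p.2.2.1) (fun p => p.2.2.2)
      {u | G.IsUpper ℓ v u} (fun _ => {u | G.IsUpper ℓ v u})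
      (fun x u => {w | G.IsUpper ℓ w x ∧ G.IsUpper ℓ w u}) ?_ ?_ ?_ ?_
    · rintro ⟨u, w, u', w'⟩ h ⟨x, y, x', y'⟩ h'
      grind
    all_goals
      rintro ⟨u, w, u', w'⟩ h
      simp only [mem_filter, mem_univ, true_and, Q] at h ⊢
      obtain ⟨⟨-, ⟨h1, h2, h3, h4⟩, h5⟩, rfl⟩ := h
    · exact ⟨h1, (hs _).trans hsd⟩
    · exact ⟨h2, hs _⟩
    · exact ⟨⟨h3, h4⟩, h5.le⟩
  have h4 : #{p | Q p ∧ v = p.2.2.2} ≤ d * (s * m) := by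
    refine card_le_of_three_choices (fun p => p.1) (fun p => p.2.2.1) (fun p => p.2.1)
      {u | G.IsUpper ℓ v u} (fun _ => {u | G.IsUpper ℓ v u})
      (fun x u => {w | G.IsUpper ℓ w x ∧ G.IsUpper ℓ w u}) ?_ ?_ ?_ ?_
    · rintro ⟨u, w, u', w'⟩ h ⟨x, y, x', y'⟩ h'
      grind
    all_goals
      rintro ⟨u, w, u', w'⟩ h
      simp only [mem_filter, mem_univ, true_and, Q] at h ⊢
      obtain ⟨⟨-, ⟨h1, h2, h3, h4⟩, h5⟩, rfl⟩ := h
    · exact ⟨h3, (hs _).trans hsd⟩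
    · exact ⟨h4, hs _⟩
    · exact ⟨⟨h1, h2⟩, h5.le⟩
  simp only [and_or_left, filter_or]
  grw [card_union_le, card_union_le, card_union_le, h1, h2, h3, h4]
  omega

open Classical Finset in
theorem card_zigzag_mem_le (hd : ∀ v, #{u | G.Adj v u} ≤ d)
    (hs : ∀ v, #{u | G.IsUpper ℓ v u} ≤ s) (hsd : s ≤ d) (v : V) :
    #{p : V × V × V × V × V | G.IsZigzag ℓ p.1 p.2.1 p.2.2.1 p.2.2.2.1 p.2.2.2.2 ∧
      (v = p.1 ∨ v = p.2.1 ∨ v = p.2.2.1 ∨ v = p.2.2.2.1 ∨ v = p.2.2.2.2)} ≤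
      5 * (d * (s * (d * s))) := by
  let Q : V × V × V × V × V → Prop :=
    fun p => G.IsZigzag ℓ p.1 p.2.1 p.2.2.1 p.2.2.2.1 p.2.2.2.2
  -- the number of zigzags with `v` in a given position
  have h1 : #{p | Q p ∧ v = p.1} ≤ d * (s * (d * s)) := by
    refine card_le_of_four_choices (fun p => p.2.1) (fun p => p.2.2.1) (fun p => p.2.2.2.1)
      (fun p => p.2.2.2.2)
      {w | G.Adj v w} (fun w => {u | G.IsUpper ℓ w u})
      (fun _ u => {w | G.Adj u w}) (fun _ _ w => {u | G.IsUpper ℓ w u}) ?_ ?_ ?_ ?_ ?_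
    · rintro ⟨u, w, u', w', u''⟩ h ⟨x, y, x', y', x''⟩ h'
      grind
    all_goals
      rintro ⟨u, w, u', w', u''⟩ h
      simp only [mem_filter, mem_univ, true_and, Q] at h ⊢
      obtain ⟨⟨-, h1, h2, h3, h4⟩, rfl⟩ := h
    · exact ⟨h1.1.symm, hd _⟩
    · exact ⟨h2, hs _⟩
    · exact ⟨h3.1.symm, hd _⟩
    · exact ⟨h4, hs _⟩
  have h2 : #{p | Q p ∧ v = p.2.2.2.2} ≤ d * (s * (d * s)) := by
    refine card_le_of_four_choices (fun p => p.2.2.2.1) (fun p => p.2.2.1) (fun p => p.2.1)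
      (fun p => p.1)
      {w | G.Adj v w} (fun w => {u | G.IsUpper ℓ w u})
      (fun _ u => {w | G.Adj u w}) (fun _ _ w => {u | G.IsUpper ℓ w u}) ?_ ?_ ?_ ?_ ?_
    · rintro ⟨u, w, u', w', u''⟩ h ⟨x, y, x', y', x''⟩ h'
      grind
    all_goals
      rintro ⟨u, w, u', w', u''⟩ h
      simp only [mem_filter, mem_univ, true_and, Q] at h ⊢
      obtain ⟨⟨-, h1, h2, h3, h4⟩, rfl⟩ := h
    · exact ⟨h4.1.symm, hd _⟩
    · exact ⟨h3, hs _⟩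
    · exact ⟨h2.1.symm, hd _⟩
    · exact ⟨h1, hs _⟩
  have h3 : #{p | Q p ∧ v = p.2.2.1} ≤ d * (s * (d * s)) := by
    refine card_le_of_four_choices (fun p => p.2.1) (fun p => p.1) (fun p => p.2.2.2.1)
      (fun p => p.2.2.2.2)
      {w | G.Adj v w} (fun w => {u | G.IsUpper ℓ w u})
      (fun _ _ => {w | G.Adj v w}) (fun _ _ w => {u | G.IsUpper ℓ w u}) ?_ ?_ ?_ ?_ ?_
    · rintro ⟨u, w, u', w', u''⟩ h ⟨x, y, x', y', x''⟩ h'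
      grind
    all_goals
      rintro ⟨u, w, u', w', u''⟩ h
      simp only [mem_filter, mem_univ, true_and, Q] at h ⊢
      obtain ⟨⟨-, h1, h2, h3, h4⟩, rfl⟩ := h
    · exact ⟨h2.1.symm, hd _⟩
    · exact ⟨h1, hs _⟩
    · exact ⟨h3.1.symm, hd _⟩
    · exact ⟨h4, hs _⟩
  have h4 : #{p | Q p ∧ v = p.2.1} ≤ d * (s * (d * s)) := by
    refine card_le_of_four_choices (fun p => p.1) (fun p => p.2.2.1) (fun p => p.2.2.2.1)
      (fun p => p.2.2.2.2)
      {u | G.IsUpper ℓ v u} (fun _ => {u | G.IsUpper ℓ v u})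
      (fun _ u => {w | G.Adj u w}) (fun _ _ w => {u | G.IsUpper ℓ w u}) ?_ ?_ ?_ ?_ ?_
    · rintro ⟨u, w, u', w', u''⟩ h ⟨x, y, x', y', x''⟩ h'
      grind
    all_goals
      rintro ⟨u, w, u', w', u''⟩ h
      simp only [mem_filter, mem_univ, true_and, Q] at h ⊢
      obtain ⟨⟨-, h1, h2, h3, h4⟩, rfl⟩ := h
    · exact ⟨h1, (hs _).trans hsd⟩
    · exact ⟨h2, hs _⟩
    · exact ⟨h3.1.symm, hd _⟩
    · exact ⟨h4, hs _⟩
  have h5 : #{p | Q p ∧ v = p.2.2.2.1} ≤ d * (s * (d * s)) := by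
    refine card_le_of_four_choices (fun p => p.2.2.2.2) (fun p => p.2.2.1) (fun p => p.2.1)
      (fun p => p.1)
      {u | G.IsUpper ℓ v u} (fun _ => {u | G.IsUpper ℓ v u})
      (fun _ u => {w | G.Adj u w}) (fun _ _ w => {u | G.IsUpper ℓ w u}) ?_ ?_ ?_ ?_ ?_
    · rintro ⟨u, w, u', w', u''⟩ h ⟨x, y, x', y', x''⟩ h'
      grind
    all_goals
      rintro ⟨u, w, u', w', u''⟩ h
      simp only [mem_filter, mem_univ, true_and, Q] at h ⊢
      obtain ⟨⟨-, h1, h2, h3, h4⟩, rfl⟩ := h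
    · exact ⟨h4, (hs _).trans hsd⟩
    · exact ⟨h3, hs _⟩
    · exact ⟨h2.1.symm, hd _⟩
    · exact ⟨h1, hs _⟩
  simp only [and_or_left, filter_or]
  grw [card_union_le, card_union_le, card_union_le, card_union_le, h1, h2, h3, h4, h5]
  omega

end Layered
end SimpleGraph

/-! ### Avoiding all excluded configurations -/

namespace SimpleGraph

section Layered
variable {V T : Type*} [LinearOrder T]

/-- The configurations excluded by `IsLayerwiseAcyclic`, as tuples of vertices. -/
abbrev Config (V : Type*) : Type _ := V × V ⊕ (V × V × V × V) ⊕ (V × V × V × V × V)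

namespace Config

open Classical in
/-- The vertices of a configuration. -/
noncomputable def supp : Config V → Finset V
  | .inl (a, b) => {a, b}
  | .inr (.inl (u, w, u', w')) => {u, w, u', w'}
  | .inr (.inr (u, w, u', w', u'')) => {u, w, u', w', u''}

/-- The number of independent equalities between colours that say that a configuration is coloured
in the excluded way. -/
def rank : Config V → ℕ
  | .inl _ => 1
  | .inr (.inl _) => 2
  | .inr (.inr _) => 3

/-- The configuration is coloured in the excluded way: a pair in one colour, a longer tuple
alternately in two colours. -/
def IsBad {α : Type*} : Config V → (V → α) → Prop
  | .inl (a, b), f => f a = f b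
  | .inr (.inl (u, w, u', w')), f => f u = f u' ∧ f w = f w'
  | .inr (.inr (u, w, u', w', u'')), f => f u = f u' ∧ f u = f u'' ∧ f w = f w'

/-- The tuple is one of the configurations of `G`. -/
def Occurs [Fintype V] (G : SimpleGraph V) (ℓ : V → T) (m : ℕ) : Config V → Prop
  | .inl (a, b) => G.Conflict ℓ m a b
  | .inr (.inl (u, w, u', w')) => G.IsThinSquare ℓ m u w u' w'
  | .inr (.inr (u, w, u', w', u'')) => G.IsZigzag ℓ u w u' w' u''

open Finset in
/-- In a configuration coloured in the excluded way, the colours of `c.rank` vertices, among them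
any prescribed vertex `v`, are determined by the colours of the other vertices: the
colour of one vertex of each colour class determines the rest of the class. -/
theorem exists_determined {α : Type*} [Fintype V] {G : SimpleGraph V} {ℓ : V → T} {m : ℕ}
    {c : Config V} (hc : c.Occurs G ℓ m) {v : V} (hv : v ∈ c.supp) :
    ∃ D : Finset V, v ∈ D ∧ #D = c.rank ∧
      ∀ f g : V → α, c.IsBad f → c.IsBad g → (∀ x ∉ D, f x = g x) → f = g := by
  classical
  rcases c with ⟨a, b⟩ | ⟨u, w, u', w'⟩ | ⟨u, w, u', w', u''⟩
  · refine ⟨{v}, mem_singleton_self v, card_singleton v, fun f g hf hg hfg => ?_⟩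
    have hab : a ≠ b := hc.1
    simp only [supp, IsBad, mem_insert, mem_singleton] at hv hf hg hfg
    funext x
    grind
  · obtain ⟨⟨h1, h2⟩, ⟨h3, h4, h5, h6⟩, -⟩ := hc
    have h3 := h3.1.ne
    have h4 := h4.1.ne
    have h5 := h5.1.ne
    have h6 := h6.1.ne
    simp only [supp, mem_insert, mem_singleton] at hv
    simp only [IsBad, rank]
    have key : ∀ y, (v = u ∨ v = u') ∧ y = w ∨ (v = w ∨ v = w') ∧ y = u →
        ∃ D : Finset V, v ∈ D ∧ #D = 2 ∧ ∀ f g : V → α, (f u = f u' ∧ f w = f w') →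
          (g u = g u' ∧ g w = g w') → (∀ x ∉ D, f x = g x) → f = g := by
      intro y hy
      refine ⟨{v, y}, by simp, card_pair (by grind), fun f g hf hg hfg => ?_⟩
      simp only [mem_insert, mem_singleton] at hfg
      funext x
      grind
    by_cases h : v = u ∨ v = u'
    · exact key w (.inl ⟨h, rfl⟩)
    · exact key u (.inr ⟨by tauto, rfl⟩)
  · obtain ⟨⟨h1, h2, h3, h4, h5, h6⟩, h7, h8, h9, h10⟩ := hc
    have h7 := h7.1.ne
    have h8 := h8.1.ne
    have h9 := h9.1.ne
    have h10 := h10.1.ne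
    simp only [supp, mem_insert, mem_singleton] at hv
    simp only [IsBad, rank]
    have key : ∀ y z, v = u ∧ y = u' ∧ z = w ∨ (v = u' ∨ v = u'') ∧ y = u ∧ z = w ∨
        (v = w ∨ v = w') ∧ y = u ∧ z = u' →
        ∃ D : Finset V, v ∈ D ∧ #D = 3 ∧ ∀ f g : V → α,
          (f u = f u' ∧ f u = f u'' ∧ f w = f w') → (g u = g u' ∧ g u = g u'' ∧ g w = g w') →
          (∀ x ∉ D, f x = g x) → f = g := by
      intro y z hy
      refine ⟨{v, y, z}, by simp, card_eq_three.2 ⟨v, y, z, ?_, ?_, ?_, rfl⟩,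
        fun f g hf hg hfg => ?_⟩
      · grind
      · grind
      · grind
      simp only [mem_insert, mem_singleton] at hfg
      funext x
      grind
    by_cases h : v = u
    · exact key u' w (.inl ⟨h, rfl, rfl⟩)
    by_cases h' : v = u' ∨ v = u''
    · exact key u w (.inr (.inl ⟨h', rfl, rfl⟩))
    · exact key u u' (.inr (.inr ⟨by tauto, rfl, rfl⟩))

end Config

open Finset in
open Classical in
theorem exists_isLayerwiseAcyclic {α : Type*} [Fintype α] [Nonempty α] [Fintype V]
    (G : SimpleGraph V) (ℓ : V → T) {d s m : ℕ} (hm : 0 < m)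
    (hd : ∀ v, #{u | G.Adj v u} ≤ d) (hs : ∀ v, #{u | G.IsUpper ℓ v u} ≤ s) (hsd : s ≤ d)
    (hα : 2 * (s + s * s + d * s / m : ℕ) * (2 / (Fintype.card α : ℝ)) +
      4 * (d * (s * m)) * (2 / (Fintype.card α : ℝ)) ^ 2 +
      5 * (d * (s * (d * s))) * (2 / (Fintype.card α : ℝ)) ^ 3 ≤ 1) :
    ∃ f : V → α, G.IsLayerwiseAcyclic ℓ m f := by
  suffices h : ∃ f : V → α, ∀ c ∈ ({c | c.Occurs G ℓ m} : Finset (Config V)), ¬ c.IsBad f by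
    obtain ⟨f, hf⟩ := h
    simp only [mem_filter, mem_univ, true_and] at hf
    exact ⟨f, fun a b h => hf (.inl (a, b)) h,
      fun u w u' w' h => hf (.inr (.inl (u, w, u', w'))) h,
      fun u w u' w' u'' h => hf (.inr (.inr (u, w, u', w', u''))) h⟩
  refine exists_forall_not_bad _ Config.supp Config.IsBad Config.rank ?_ ?_ ?_ ?_
  · rintro (⟨a, b⟩ | ⟨u, w, u', w'⟩ | ⟨u, w, u', w', u''⟩) - <;> exact insert_nonempty _ _
  · rintro (⟨a, b⟩ | ⟨u, w, u', w'⟩ | ⟨u, w, u', w', u''⟩) - f g h hf <;>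
      simp only [Config.supp, Config.IsBad, mem_insert, mem_singleton] at h hf ⊢ <;> grind
  · intro c hc v hv
    exact Config.exists_determined (mem_filter.1 hc).2 hv
  · intro v
    set q := 2 / (Fintype.card α : ℝ) with hq
    have hq0 : 0 ≤ q := by positivity
    refine le_trans (le_of_eq ?_) ((add_le_add (add_le_add
      (mul_le_mul_of_nonneg_right (Nat.cast_le.2 (G.card_conflict_mem_le ℓ m hm hd hs v)) hq0)
      (mul_le_mul_of_nonneg_right (Nat.cast_le.2 (G.card_thinSquare_mem_le ℓ m hd hs hsd v))
        (pow_nonneg hq0 2)))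
      (mul_le_mul_of_nonneg_right (Nat.cast_le.2 (G.card_zigzag_mem_le ℓ hd hs hsd v))
        (pow_nonneg hq0 3))).trans (le_of_eq_of_le (by push_cast; ring) hα))
    rw [filter_filter, sum_filter, Fintype.sum_sum_type, Fintype.sum_sum_type, ← add_assoc]
    simp only [← sum_filter, Config.Occurs, Config.supp, Config.rank, mem_insert, mem_singleton,
      sum_const, nsmul_eq_mul, pow_one]

end Layered
end SimpleGraph

/-! ### From layerwise colourings to acyclic colourings -/

namespace SimpleGraph

theorem Walk.IsCycle.exists_isCycle_of_induce {V : Type*} {G : SimpleGraph V} {s : Set V} {v : s}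
    {c : (G.induce s).Walk v v} (hc : c.IsCycle) :
    ∃ (u : V) (p : G.Walk u u), p.IsCycle ∧ ∀ x ∈ p.support, x ∈ s := by
  refine ⟨_, c.map (Embedding.induce s).toHom, hc.map (f := (Embedding.induce s).toHom)
    (Embedding.induce s : G.induce s ↪g G).injective, fun x hx => ?_⟩
  rw [Walk.support_map, List.mem_map] at hx
  obtain ⟨y, -, rfl⟩ := hx
  exact y.2

section Layered
variable {V T α : Type*} [LinearOrder T] [Fintype V] {G : SimpleGraph V} {ℓ : V → T} {m : ℕ}
  {f : V → α}

theorem IsLayerwiseAcyclic.prod_ne (hf : G.IsLayerwiseAcyclic ℓ m f) {v w : V} (h : G.Adj v w) :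
    (ℓ v, f v) ≠ (ℓ w, f w) := by
  intro heq
  rw [Prod.mk.injEq] at heq
  exact hf.conflict v w ⟨h.ne, .inl ⟨heq.1, .inl h⟩⟩ heq.2

/-- No cycle is coloured with two colours `a` and `b` from different layers. Such a cycle `p`,
started at a vertex of the higher layer, alternates between the layers, so that it has even length.
If the length is four, then it is a thin square or its two higher vertices are in conflict; if it is
longer, then its first five vertices form a zigzag. -/
theorem IsLayerwiseAcyclic.not_isCycle_of_lt (hf : G.IsLayerwiseAcyclic ℓ m f) {a b : T × α}
    (hab : a.1 < b.1) {v : V} (p : G.Walk v v) (hp : p.IsCycle) (hv : (ℓ v, f v) = b)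
    (hsupp : ∀ x ∈ p.support, (ℓ x, f x) = a ∨ (ℓ x, f x) = b) : False := by
  have h3 := hp.three_le_length
  have hcol : ∀ i, (ℓ (p.getVert i), f (p.getVert i)) = a ∨
      (ℓ (p.getVert i), f (p.getVert i)) = b := fun i => hsupp _ (p.getVert_mem_support i)
  have hadj : ∀ i < p.length, G.Adj (p.getVert i) (p.getVert (i + 1)) := fun i hi =>
    p.adj_getVert_succ hi
  have hab' : a ≠ b := fun h => hab.ne (congrArg Prod.fst h)
  have hflip : ∀ i < p.length, (ℓ (p.getVert i), f (p.getVert i)) = a ↔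
      (ℓ (p.getVert (i + 1)), f (p.getVert (i + 1))) = b := by
    intro i hi
    have h1 := hf.prod_ne (hadj i hi)
    have h2 := hcol i
    have h3 := hcol (i + 1)
    grind
  have hinj : ∀ i j, i < p.length → j < p.length → p.getVert i = p.getVert j → i = j :=
    fun i j hi hj h => hp.getVert_injOn' (by simp only [Set.mem_ofPred_eq]; omega)
      (by simp only [Set.mem_ofPred_eq]; omega) h
  have c0 : (ℓ (p.getVert 0), f (p.getVert 0)) = b := by rwa [p.getVert_zero]
  have c1 : (ℓ (p.getVert 1), f (p.getVert 1)) = a := by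
    have := hflip 0 (by omega); have := hcol 1; grind
  have c2 : (ℓ (p.getVert 2), f (p.getVert 2)) = b := by
    have := hflip 1 (by omega); grind
  have hlen : p.length ≠ 3 := by
    intro h
    have := hflip 2 (by omega)
    have h03 : p.getVert 3 = v := by rw [← h, p.getVert_length]
    rw [h03, hv] at this
    grind
  have c3 : (ℓ (p.getVert 3), f (p.getVert 3)) = a := by
    have := hflip 2 (by omega); have := hcol 3; grind
  have c4 : (ℓ (p.getVert 4), f (p.getVert 4)) = b := by
    have := hflip 3 (by omega); grind
  have up : ∀ x y, G.Adj x y → (ℓ x, f x) = a → (ℓ y, f y) = b → G.IsUpper ℓ x y := by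
    rintro x y h rfl rfl
    exact ⟨h, hab.le⟩
  have u10 := up _ _ (hadj 0 (by omega)).symm c1 c0
  have u12 := up _ _ (hadj 1 (by omega)) c1 c2
  have u32 := up _ _ (hadj 2 (by omega)).symm c3 c2
  have u34 := up _ _ (hadj 3 (by omega)) c3 c4
  have hne : ∀ i j, i < j → j < p.length → p.getVert i ≠ p.getVert j := fun i j hij hj h =>
    hij.ne (hinj i j (hij.trans hj) hj h)
  have f02 : f (p.getVert 0) = f (p.getVert 2) := congrArg Prod.snd (c0.trans c2.symm)
  have f04 : f (p.getVert 0) = f (p.getVert 4) := congrArg Prod.snd (c0.trans c4.symm)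
  have f13 : f (p.getVert 1) = f (p.getVert 3) := congrArg Prod.snd (c1.trans c3.symm)
  by_cases h4 : p.length = 4
  · have e4 : p.getVert 4 = p.getVert 0 := by rw [← h4, p.getVert_length, p.getVert_zero]
    rw [e4] at u34
    rcases lt_or_ge (G.codegree ℓ (p.getVert 0) (p.getVert 2)) m with hm | hm
    · exact hf.square _ _ _ _ ⟨⟨hne 0 2 (by omega) (by omega), hne 1 3 (by omega) (by omega)⟩,
        ⟨u10, u12, u34, u32⟩, hm⟩ ⟨f02, f13⟩
    · exact hf.conflict _ _ ⟨hne 0 2 (by omega) (by omega), .inr hm⟩ f02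
  · exact hf.zigzag _ _ _ _ _ ⟨⟨hne 0 2 (by omega) (by omega), hne 0 4 (by omega) (by omega),
      hne 2 4 (by omega) (by omega), hne 1 3 (by omega) (by omega), hne 1 4 (by omega) (by omega),
      (hne 0 3 (by omega) (by omega)).symm⟩, u10, u12, u32, u34⟩ ⟨f02, f04, f13⟩

/-- No cycle is coloured with two colours from the same layer, since its first and third vertex
would be in conflict. -/
theorem IsLayerwiseAcyclic.not_isCycle_of_eq (hf : G.IsLayerwiseAcyclic ℓ m f) {a b : T × α}
    (hab : a.1 = b.1) {v : V} (p : G.Walk v v) (hp : p.IsCycle)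
    (hsupp : ∀ x ∈ p.support, (ℓ x, f x) = a ∨ (ℓ x, f x) = b) : False := by
  have h3 := hp.three_le_length
  have hadj : ∀ i < p.length, G.Adj (p.getVert i) (p.getVert (i + 1)) := fun i hi =>
    p.adj_getVert_succ hi
  have hcol : ∀ i, (ℓ (p.getVert i), f (p.getVert i)) = a ∨
      (ℓ (p.getVert i), f (p.getVert i)) = b := fun i => hsupp _ (p.getVert_mem_support i)
  have h01 := hadj 0 (by omega)
  have h12 := hadj 1 (by omega)
  have hne : p.getVert 0 ≠ p.getVert 2 := fun h => absurd (hp.getVert_injOn'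
    (by simp only [Set.mem_ofPred_eq]; omega) (by simp only [Set.mem_ofPred_eq]; omega) h)
    (by norm_num)
  have n01 := hf.prod_ne h01
  have n12 := hf.prod_ne h12
  have e02 : (ℓ (p.getVert 0), f (p.getVert 0)) = (ℓ (p.getVert 2), f (p.getVert 2)) := by
    have := hcol 0; have := hcol 1; have := hcol 2
    grind
  have hl : ∀ i, ℓ (p.getVert i) = b.1 := by
    intro i
    rcases hcol i with h | h
    · rw [← hab, ← h]
    · rw [← h]
  exact hf.conflict _ _ ⟨hne, .inl ⟨(hl 0).trans (hl 2).symm, .inr ⟨p.getVert 1,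
    (hl 1).trans (hl 0).symm, h01, h12⟩⟩⟩ (congrArg Prod.snd e02)

theorem IsLayerwiseAcyclic.acyclicColorable [Fintype T] [Fintype α]
    (hf : G.IsLayerwiseAcyclic ℓ m f) :
    G.AcyclicColorable (Fintype.card T * Fintype.card α) := by
  classical
  let e : T × α ≃ Fin (Fintype.card T * Fintype.card α) :=
    Fintype.equivFinOfCardEq (Fintype.card_prod T α)
  refine ⟨Coloring.mk (fun v => e (ℓ v, f v)) fun h heq => hf.prod_ne h (e.injective heq), ?_⟩
  intro a' b' v c hc
  obtain ⟨u, p, hp, hps⟩ := hc.exists_isCycle_of_induce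
  obtain ⟨a, rfl⟩ := e.surjective a'
  obtain ⟨b, rfl⟩ := e.surjective b'
  have hsupp : ∀ x ∈ p.support, (ℓ x, f x) = a ∨ (ℓ x, f x) = b := fun x hx =>
    (hps x hx).imp (fun h => e.injective h) fun h => e.injective h
  have h3 := hp.three_le_length
  -- one of two consecutive vertices of the cycle lies in the upper layer
  have hstart : ∀ a b : T × α, a.1 < b.1 →
      (∀ x ∈ p.support, (ℓ x, f x) = a ∨ (ℓ x, f x) = b) → False := by
    intro a b hab hs
    obtain ⟨u, hu, hub⟩ : ∃ u ∈ p.support, (ℓ u, f u) = b := by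
      by_contra! hcon
      have h0 := (hs _ (p.getVert_mem_support 0)).resolve_right (hcon _ (p.getVert_mem_support 0))
      have h1 := (hs _ (p.getVert_mem_support 1)).resolve_right (hcon _ (p.getVert_mem_support 1))
      exact hf.prod_ne (p.adj_getVert_succ (i := 0) (by omega)) (h0.trans h1.symm)
    exact hf.not_isCycle_of_lt hab (p.rotate u hu) (hp.rotate hu) hub fun x hx =>
      hs x (by simpa using hx)
  rcases lt_trichotomy a.1 b.1 with h | h | h
  · exact hstart a b h hsupp
  · exact hf.not_isCycle_of_eq h p hp hsupp
  · exact hstart b a h fun x hx => (hsupp x hx).symm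

end Layered
end SimpleGraph

/-! ### The bound -/

/-- The hypothesis of `exists_isLayerwiseAcyclic` holds if the threshold `m` is about `(d s)^(1/3)`
and the number `k` of colours is at least `20 z`, where `z` bounds both `s ^ 2` and
`(d s)^(2/3)`. The factor `20` leaves room: the sum is then at most `137 / 200`. -/
theorem weight_sum_le_one {s d m : ℕ} {y z k : ℝ} (hs : 1 ≤ s) (hy : 1 ≤ y)
    (hy3 : y ^ 3 = d * s) (hym : y ≤ m) (hmy : (m : ℝ) ≤ 2 * y) (hsz : (s : ℝ) ^ 2 ≤ z)
    (hyz : y ^ 2 ≤ z) (hk : 20 * z ≤ k) :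
    2 * (s + s * s + d * s / m : ℕ) * (2 / k) + 4 * (d * (s * m)) * (2 / k) ^ 2 +
      5 * (d * (s * (d * s))) * (2 / k) ^ 3 ≤ 1 := by
  have hz : 0 < z := by nlinarith
  have hk0 : 0 < k := by linarith
  have hq : 2 / k ≤ 1 / (10 * z) := by
    rw [div_le_div_iff₀ hk0 (by positivity)]
    linarith
  have hq0 : 0 ≤ 2 / k := by positivity
  have hs1 : (1 : ℝ) ≤ s := by exact_mod_cast hs
  have hm0 : (0 : ℝ) < m := by linarith
  have h1 : ((s + s * s + d * s / m : ℕ) : ℝ) ≤ 3 * z := by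
    have hdiv : ((d * s / m : ℕ) : ℝ) ≤ y ^ 2 := by
      refine Nat.cast_div_le.trans ?_
      rw [div_le_iff₀ hm0]
      push_cast
      rw [← hy3, pow_succ]
      gcongr
    push_cast
    nlinarith
  have h2 : (d * (s * m) : ℝ) ≤ 2 * z ^ 2 := by
    calc (d * (s * m) : ℝ) = y ^ 3 * m := by rw [hy3]; ring
      _ ≤ y ^ 3 * (2 * y) := by gcongr
      _ = 2 * (y ^ 2) ^ 2 := by ring
      _ ≤ 2 * z ^ 2 := by gcongr
  have h3 : (d * (s * (d * s)) : ℝ) ≤ z ^ 3 := by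
    calc (d * (s * (d * s)) : ℝ) = y ^ 3 * y ^ 3 := by rw [hy3]; ring
      _ = (y ^ 2) ^ 3 := by ring
      _ ≤ z ^ 3 := by gcongr
  calc _ ≤ 2 * (3 * z) * (1 / (10 * z)) + 4 * (2 * z ^ 2) * (1 / (10 * z)) ^ 2 +
        5 * z ^ 3 * (1 / (10 * z)) ^ 3 := by gcongr
    _ = 137 / 200 := by
      field_simp
      norm_num
    _ ≤ 1 := by norm_num

namespace SimpleGraph

open Classical Finset in
theorem acyclicColorable_of_layering {V : Type*} [Fintype V] (G : SimpleGraph V)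
    {t d : ℕ} (ht : 1 ≤ t) (hd : 1 ≤ d) (hdeg : ∀ v, #{u | G.Adj v u} ≤ d)
    {ℓ : V → Fin t} (hℓ : ∀ v, #{u | G.IsUpper ℓ v u} ≤ t) :
    G.AcyclicColorable (t * ⌈20 * ((t : ℝ) ^ (5 / 3 : ℝ) * (d : ℝ) ^ (2 / 3 : ℝ))⌉₊) := by
  set z : ℝ := (t : ℝ) ^ (5 / 3 : ℝ) * (d : ℝ) ^ (2 / 3 : ℝ) with hzdef
  -- a vertex has at most `s` upper neighbours
  set s := min t d with hsdef
  -- `y ^ 2` is the number of colours at which the counts of thin squares and of zigzags balance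
  set y : ℝ := ((d * s : ℕ) : ℝ) ^ (1 / 3 : ℝ) with hydef
  have hs : 1 ≤ s := le_min ht hd
  have hs1 : (1 : ℝ) ≤ s := by exact_mod_cast hs
  have hd1 : (1 : ℝ) ≤ d := by exact_mod_cast hd
  have ht1 : (1 : ℝ) ≤ t := by exact_mod_cast ht
  have hst : (s : ℝ) ≤ t := by exact_mod_cast min_le_left t d
  have hsd : (s : ℝ) ≤ d := by exact_mod_cast min_le_right t d
  have hds : (1 : ℝ) ≤ (d * s : ℕ) := by exact_mod_cast Nat.mul_pos hd hs
  have hy : 1 ≤ y := Real.one_le_rpow hds (by norm_num)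
  have hy3 : y ^ 3 = d * s := by
    rw [hydef, ← Real.rpow_natCast, ← Real.rpow_mul (by positivity)]
    norm_num
  have hsz : (s : ℝ) ^ 2 ≤ z := by
    calc (s : ℝ) ^ 2 = (s : ℝ) ^ (2 : ℝ) := (Real.rpow_two _).symm
      _ ≤ (s : ℝ) ^ (5 / 3 + 2 / 3 : ℝ) := Real.rpow_le_rpow_of_exponent_le hs1 (by norm_num)
      _ = (s : ℝ) ^ (5 / 3 : ℝ) * (s : ℝ) ^ (2 / 3 : ℝ) := Real.rpow_add (by positivity) _ _
      _ ≤ z := by rw [hzdef]; gcongr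
  have hyz : y ^ 2 ≤ z := by
    calc y ^ 2 = ((d * s : ℕ) : ℝ) ^ (2 / 3 : ℝ) := by
          rw [hydef, ← Real.rpow_natCast, ← Real.rpow_mul (by positivity)]
          norm_num
      _ = (s : ℝ) ^ (2 / 3 : ℝ) * (d : ℝ) ^ (2 / 3 : ℝ) := by
          rw [Nat.cast_mul, Real.mul_rpow (by positivity) (by positivity), mul_comm]
      _ ≤ (t : ℝ) ^ (2 / 3 : ℝ) * (d : ℝ) ^ (2 / 3 : ℝ) := by gcongr
      _ ≤ z := by
          rw [hzdef]
          gcongr ?_ * _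
          exact Real.rpow_le_rpow_of_exponent_le ht1 (by norm_num)
  have hk0 : 0 < ⌈20 * z⌉₊ := Nat.ceil_pos.2 (by nlinarith)
  have : Nonempty (Fin ⌈20 * z⌉₊) := ⟨⟨0, hk0⟩⟩
  have hs' : ∀ v, #{u | G.IsUpper ℓ v u} ≤ s := fun v =>
    le_min (hℓ v) ((card_le_card fun u hu => by simpa using (mem_filter.1 hu).2.1).trans (hdeg v))
  obtain ⟨f, hf⟩ := G.exists_isLayerwiseAcyclic (α := Fin ⌈20 * z⌉₊) ℓ
    (m := ⌈y⌉₊) (Nat.ceil_pos.2 (by linarith)) hdeg hs' (min_le_right t d)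
    (weight_sum_le_one hs hy hy3 (Nat.le_ceil y)
      ((Nat.ceil_lt_add_one (by linarith)).le.trans (by linarith)) hsz hyz
      (by rw [Fintype.card_fin]; exact Nat.le_ceil _))
  simpa using hf.acyclicColorable

end SimpleGraph

theorem mainTheorem3 :
    ∃ C : ℝ, 0 < C ∧
      ∀ (W : Type*) [Fintype W] (F : SimpleGraph W), F.IsAcyclic →
      ∀ d : ℕ, 1 ≤ d →
      ∀ (V : Type*) [Fintype V] (G : SimpleGraph V) [DecidableRel G.Adj],
        F.Free G → G.maxDegree ≤ d →
        (G.acyclicChromaticNumber : ℝ) ≤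
          C * (Fintype.card W : ℝ) ^ (8 / 3 : ℝ) * (d : ℝ) ^ (2 / 3 : ℝ) := by
  classical
  refine ⟨21, by norm_num, fun W _ F hF d hd V _ G _ hfree hdeg => ?_⟩
  have ht : 1 ≤ Fintype.card W := by
    by_contra hcon
    have := Fintype.card_eq_zero_iff.1 (by omega : Fintype.card W = 0)
    exact hfree (SimpleGraph.IsContained.of_isEmpty)
  obtain ⟨ℓ, hℓ⟩ := hF.exists_layering hfree
  have hdeg' : ∀ v, (Finset.univ.filter fun u => G.Adj v u).card ≤ d := fun v => by
    rw [← SimpleGraph.neighborFinset_eq_filter]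
    exact (G.degree_le_maxDegree v).trans hdeg
  have hχ : G.acyclicChromaticNumber ≤ _ :=
    Nat.sInf_le (G.acyclicColorable_of_layering ht hd (fun v => by convert hdeg' v) hℓ)
  have ht1 : (1 : ℝ) ≤ Fintype.card W := by exact_mod_cast ht
  have hd1 : (1 : ℝ) ≤ d := by exact_mod_cast hd
  set t : ℝ := (Fintype.card W : ℝ)
  have hz : 1 ≤ t ^ (5 / 3 : ℝ) * (d : ℝ) ^ (2 / 3 : ℝ) :=
    one_le_mul_of_one_le_of_one_le (Real.one_le_rpow ht1 (by norm_num))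
      (Real.one_le_rpow hd1 (by norm_num))
  have hpow : t ^ (8 / 3 : ℝ) = t * t ^ (5 / 3 : ℝ) := by
    rw [← Real.rpow_one_add' (by positivity) (by norm_num)]
    norm_num
  calc (G.acyclicChromaticNumber : ℝ)
      ≤ t * ⌈20 * (t ^ (5 / 3 : ℝ) * (d : ℝ) ^ (2 / 3 : ℝ))⌉₊ :=
        (Nat.cast_le.2 hχ).trans_eq (Nat.cast_mul _ _)
    _ ≤ t * (21 * (t ^ (5 / 3 : ℝ) * (d : ℝ) ^ (2 / 3 : ℝ))) := by
        gcongr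
        have := Nat.ceil_lt_add_one
          (by positivity : 0 ≤ 20 * (t ^ (5 / 3 : ℝ) * (d : ℝ) ^ (2 / 3 : ℝ)))
        linarith
    _ = 21 * t ^ (8 / 3 : ℝ) * (d : ℝ) ^ (2 / 3 : ℝ) := by rw [hpow]; ring
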